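/- **Corollary (Support recovery).** Let $f:\mathbb{R}^n\to\mathbb{R}$ be differentiable and bounded below, and put $B=\inf_x f(x)$ (this is $\min_x f(x)$ when the minimum is attained). Write $\mathrm{supp}(x)=\{i: x_i\neq 0\}$. For $k\in\mathbb{N}$ let $\rho_k^+$ be the least $\rho\in\mathbb{R}$ such that $f(y)\le f(x)+\nabla f(x)^\top(y-x)+\frac{\rho}{2}\|y-x\|_2^2$ for all $x,y$ with $|\mathrm{supp}(y-x)|\le k$, and let $\rho_k^-$ be the largest $\rho\ge 0$ such that $f(y)\ge f(x)+\nabla f(x)^\top(y-x)+\frac{\rho}{2}\|y-x\|_2^2$ for all such $x,y$. Let $x^*\neq 0$ be $s^*$-sparse with support $S^*$, and suppose that $x^*$ is locally optimal on its support, i.e. $\nabla_i f(x^*)=0$ for all $i\in S^*$. Let $x^*_{\min}$ be a nonzero entry of $x^*$ of least magnitude. Let $s\in\mathbb{N}$ and let $\zeta$ be the least $\zeta\ge 0$ with $|\langle\nabla f(x^*),y\rangle|\le\zeta\|y\|_2$ for all $s$-sparse $y$. Put $\rho^+=\rho_2^+$ (assumed finite), $\rho^-=\rho_{s+s^*}^-$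 (assumed positive) and $\widetilde\kappa=\rho^+/\rho^-$. Assume $$s\ \ge\ s^*\max\{4\widetilde\kappa+7,\ 12\widetilde\kappa+6\},\qquad |x^*_{\min}|>\frac{\zeta}{\rho^-},\qquad 0<\varepsilon<-\frac{\zeta^2}{2\rho^-}+\frac{\rho^-}{2}(x^*_{\min})^2 .$$ Then, with probability at least $1-\frac1n$, the randomized algorithm $\mathrm{ARHT}(s,\varepsilon)$ described below returns an $s$-sparse solution $x$ with $S^*\subseteq\mathrm{supp}(x)$, however ties in the choices of $i$ and $j$ are broken. *Algorithm.* For $R\subseteq[n]$ let $g_R(x)=f(x)+\frac{\rho_2^+}{2}\sum_{i\in R}x_i^2$. Logarithms are natural, and iteration counts are rounded up to the next integer (and to $0$ if negative). $\mathrm{ARHT\_core}(s,\mathrm{opt},\epsilon)$: start with $R^0=[n]$, $S^0=\{i\in[n]: i\le s\}$ and $x^0=\mathrm{argmin}_{\mathrm{supp}(x)\subseteq S^0}\,g_{R^0}(x)$. For $t=0,\dots,T-1$, where $T=2s\log\frac{f(0)-B}{\epsilon}$: * if $\min_{\mathrm{supp}(x)\subseteq S^t}f(x)\le\mathrm{opt}$,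 return the minimizer; * let $i\in\mathrm{argmax}_{i\in[n]}|\nabla_i g_{R^t}(x^t)|$, $j\in\mathrm{argmin}_{j\in S^t}|x^t_j|$, $S'=(S^t\cup\{i\})\setminus\{j\}$ and $x'=\mathrm{argmin}_{\mathrm{supp}(x)\subseteq S'}\,g_{R^t}(x)$; * if $g_{R^t}(x^t)-g_{R^t}(x')\ge\frac1s(g_{R^t}(x^t)-\mathrm{opt})$, put $S^{t+1}=S'$, $R^{t+1}=R^t$, $x^{t+1}=x'$; * otherwise sample $i\in R^t$ with probability proportional to $(x^t_i)^2$ and put $S^{t+1}=S^t$, $R^{t+1}=R^t\setminus\{i\}$ (with $R^{t+1}=R^t$ if $x^t$ vanishes on $R^t$) and $x^{t+1}=\mathrm{argmin}_{\mathrm{supp}(x)\subseteq S^{t+1}}\,g_{R^{t+1}}(x)$. If the loop ends, return $x^T$. $\mathrm{ARHT\_robust}(s,\mathrm{opt},\epsilon,B)$: start with $x^{\mathrm{ret}}=0$, make $5\log\bigl(6n\log\frac{f(0)-B}{\epsilon}\bigr)$ independent calls $x=\mathrm{ARHT\_core}(s,\mathrm{opt},\epsilon)$, each time replacing $x^{\mathrm{ret}}$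 by $x$ if $f(x)<f(x^{\mathrm{ret}})$, and return $x^{\mathrm{ret}}$. $\mathrm{ARHT}(s,\varepsilon)$: start with $l=B$, $b=0$, $r=f(0)$. While $r-l>\varepsilon$: let $m=\frac{l+r}{2}$ and $x=\mathrm{ARHT\_robust}(s,m,\varepsilon/3,B)$; if $f(x)>m+\varepsilon/3$ put $l=m$, otherwise put $b=x$ and $r=f(x)$. Return $b$. -/

import Mathlib

open scoped Gradient

noncomputable section

namespace ARHT

/-- The Euclidean space of dimension `n`. -/
abbrev E (n : ℕ) := EuclideanSpace ℝ (Fin n)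

variable {n : ℕ}

/-- The support of a vector. -/
def supp (x : E n) : Finset (Fin n) := {i | x i ≠ 0}

/-- The vector `x_R`, equal to `x` on `R` and to zero elsewhere. -/
def restrict (x : E n) (R : Finset (Fin n)) : E n :=
  WithLp.toLp 2 fun i => if i ∈ R then x i else 0

/-- `ρ` is an admissible restricted smoothness parameter of `f` at sparsity level `k`. -/
def IsRSS (f : E n → ℝ) (k : ℕ) (ρ : ℝ) : Prop :=
  ∀ x y : E n, (supp (y - x)).card ≤ k →
    f y ≤ f x + inner ℝ (∇ f x) (y - x) + ρ / 2 * ‖y - x‖ ^ 2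

/-- `ρ` is an admissible restricted strong convexity parameter of `f` at sparsity level `k`. -/
def IsRSC (f : E n → ℝ) (k : ℕ) (ρ : ℝ) : Prop :=
  ∀ x y : E n, (supp (y - x)).card ≤ k →
    f x + inner ℝ (∇ f x) (y - x) + ρ / 2 * ‖y - x‖ ^ 2 ≤ f y

/-- The restricted smoothness constant `ρ_k^+`, the least admissible parameter. -/
def rss (f : E n → ℝ) (k : ℕ) : ℝ := sInf {ρ : ℝ | IsRSS f k ρ}

/-- The restricted strong convexity constant `ρ_k^-`, the largest admissible
nonnegative parameter. -/
def rsc (f : E n → ℝ) (k : ℕ) : ℝ := sSup {ρ : ℝ | 0 ≤ ρ ∧ IsRSC f k ρ}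

/-- The restricted gradient optimal constant `ζ_k` of `f` at `z`. -/
def rgoc (f : E n → ℝ) (z : E n) (k : ℕ) : ℝ :=
  sInf {ζ : ℝ | 0 ≤ ζ ∧ ∀ y : E n, (supp y).card ≤ k → |inner ℝ (∇ f z) y| ≤ ζ * ‖y‖}

/-- The least magnitude of a nonzero entry of `x` (with value `0` for the zero vector, which
has no such entry). -/
def minAbs (x : E n) : ℝ := ⨅ i : {i : Fin n // x i ≠ 0}, |x i|

/-- `x` is an `S`-restricted minimizer of `g`. -/
def IsRestrictedMinimizer (g : E n → ℝ) (S : Finset (Fin n)) (x : E n) : Prop :=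
  supp x ⊆ S ∧ ∀ y : E n, supp y ⊆ S → g x ≤ g y

open Classical in
/-- `argmin_{supp x ⊆ S} g x`. The value `0` is used only if there is no restricted minimizer. -/
def argminOn (g : E n → ℝ) (S : Finset (Fin n)) : E n :=
  if h : ∃ x, IsRestrictedMinimizer g S x then h.choose else 0

/-- A rule that selects the coordinate to insert, `argmax_{i ∈ [n]} |v_i|`, and the coordinate to
remove, `argmin_{j ∈ S} |x_j|`; ties are broken in an arbitrary way. -/
structure SelectionRule (n : ℕ) where
  argmax : E n → Fin n
  argmax_spec : ∀ (v : E n) (i : Fin n), |v i| ≤ |v (argmax v)|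
  argmin : Finset (Fin n) → E n → Fin n
  argmin_mem : ∀ (S : Finset (Fin n)) (x : E n), S.Nonempty → argmin S x ∈ S
  argmin_spec : ∀ (S : Finset (Fin n)) (x : E n), ∀ j ∈ S, |x (argmin S x)| ≤ |x j|

/-- The regularized objective `g_R(x) = f(x) + (ρ_2^+ / 2) ‖x_R‖²`. -/
def reg (f : E n → ℝ) (R : Finset (Fin n)) (x : E n) : ℝ :=
  f x + rss f 2 / 2 * ‖restrict x R‖ ^ 2

/-- Sampling weights: `x_i²` on `R`, zero elsewhere. -/
def weight (R : Finset (Fin n)) (x : E n) (i : Fin n) : ENNReal :=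
  if i ∈ R then ENNReal.ofReal (x i ^ 2) else 0

theorem tsum_weight_ne_top (R : Finset (Fin n)) (x : E n) : ∑' i, weight R x i ≠ ⊤ := by
  rw [tsum_fintype]
  refine ENNReal.sum_ne_top.2 fun i _ => ?_
  unfold weight
  split_ifs <;> simp

open Classical in
/-- The random set `R \ {i}`, where `i ∈ R` is sampled with probability proportional to `x_i²`.
If `x` vanishes on `R`, nothing can be sampled and `R` is kept. -/
def unregularize (R : Finset (Fin n)) (x : E n) : PMF (Finset (Fin n)) :=
  if h : ∑' i, weight R x i ≠ 0 then
    (PMF.normalize (weight R x) h (tsum_weight_ne_top R x)).map fun i => R.erase i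
  else PMF.pure R

open Classical in
/-- The main loop of the core routine, with `k` iterations left and current state `(S, R, x)`. -/
def coreLoop (f : E n → ℝ) (σ : SelectionRule n) (s : ℕ) (opt : ℝ) :
    ℕ → Finset (Fin n) → Finset (Fin n) → E n → PMF (E n)
  | 0, _, _, x => PMF.pure x
  | k + 1, S, R, x =>
    if f (argminOn f S) ≤ opt then PMF.pure (argminOn f S)
    else
      let i := σ.argmax (∇ (reg f R) x)
      let j := σ.argmin S x
      let S' := (S ∪ {i}) \ {j}
      let x' := argminOn (reg f R) S'
      if reg f R x - reg f R x' < 1 / (s : ℝ) * (reg f R x - opt) then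
        (unregularize R x).bind fun R' => coreLoop f σ s opt k S R' (argminOn (reg f R') S)
      else coreLoop f σ s opt k S' R x'

/-- `ARHT_core(s, opt, ε)`. The initial support consists of the first `s` coordinates, and the
number of iterations is `2 s log ((f(0) - min f) / ε)`, rounded up. -/
def core (f : E n → ℝ) (σ : SelectionRule n) (s : ℕ) (opt ε : ℝ) : PMF (E n) :=
  let S₀ : Finset (Fin n) := {i | (i : ℕ) < s}
  coreLoop f σ s opt ⌈2 * (s : ℝ) * Real.log ((f 0 - ⨅ x, f x) / ε)⌉₊ S₀ Finset.univ
    (argminOn (reg f Finset.univ) S₀)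

open Classical in
/-- `k` further independent calls of the core routine, keeping the best solution found. -/
def robustLoop (f : E n → ℝ) (σ : SelectionRule n) (s : ℕ) (opt ε : ℝ) : ℕ → E n → PMF (E n)
  | 0, best => PMF.pure best
  | k + 1, best => (core f σ s opt ε).bind fun x =>
      robustLoop f σ s opt ε k (if f x < f best then x else best)

/-- `ARHT_robust(s, opt, ε, B)`, which makes `5 log (6 n log ((f(0) - B) / ε))` calls of the core
routine (rounded up). -/
def robust (f : E n → ℝ) (σ : SelectionRule n) (s : ℕ) (opt ε B : ℝ) : PMF (E n) :=
  robustLoop f σ s opt ε ⌈5 * Real.log (6 * (n : ℝ) * Real.log ((f 0 - B) / ε))⌉₊ 0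

/-- One pass of the search loop below decreases `r - l` by more than `ε / 6`. -/
theorem floor_lt_floor {ε L L' : ℝ} (hε : 0 < ε) (hL : ε < L) (h : L' ≤ L / 2 + ε / 3) :
    ⌊6 * L' / ε⌋₊ < ⌊6 * L / ε⌋₊ := by
  have h6 : 6 < 6 * L / ε := by rw [lt_div_iff₀ hε]; linarith
  have h1 : 6 * L' / ε + 1 ≤ 6 * L / ε := by
    rw [← sub_nonneg]
    have : 6 * L / ε - (6 * L' / ε + 1) = (6 * L - 6 * L' - ε) / ε := by field_simp; ring
    rw [this]
    exact div_nonneg (by linarith) hε.le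
  rcases le_or_gt 0 (6 * L' / ε) with h0 | h0
  · have h2 : ⌊6 * L' / ε + 1⌋₊ ≤ ⌊6 * L / ε⌋₊ := Nat.floor_le_floor h1
    rw [Nat.floor_add_one h0] at h2
    omega
  · rw [Nat.floor_of_nonpos h0.le]
    exact Nat.floor_pos.2 (by linarith)

open Classical in
/-- The search loop of ARHT with state `(l, b, r)`: while `r - l > ε`, run the robust routine for
the guess `m = (l + r) / 2`. -/
def searchLoop (f : E n → ℝ) (σ : SelectionRule n) (s : ℕ) (B ε : ℝ) (hε : 0 < ε)
    (l : ℝ) (b : E n) (r : ℝ) : PMF (E n) :=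
  if _hrl : ε < r - l then
    (robust f σ s ((l + r) / 2) (ε / 3) B).bind fun x =>
      if _hx : (l + r) / 2 + ε / 3 < f x then searchLoop f σ s B ε hε ((l + r) / 2) b r
      else searchLoop f σ s B ε hε l x (f x)
  else PMF.pure b
termination_by ⌊6 * (r - l) / ε⌋₊
decreasing_by
  · exact floor_lt_floor hε _hrl (by linarith)
  · exact floor_lt_floor hε _hrl (by linarith)

/-- The law of the output of `ARHT(s, ε)` for the objective `f`. -/
def arht (f : E n → ℝ) (σ : SelectionRule n) (s : ℕ) (ε : ℝ) (hε : 0 < ε) : PMF (E n) :=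
  searchLoop f σ s (⨅ x, f x) ε hε (⨅ x, f x) 0 (f 0)

end ARHT

end

namespace ARHT

variable {n : ℕ}

/-! Write m for `ρ⁻`, p for `ρ⁺`, κ = p/m, t for the sparsity bound on `xstar`, T for its support,
and v for the gradient of the regularized objective at x.

Recovery from value (`supp_subset_of_le`): a sparse x that misses a coordinate of T has, by strong
convexity at `xstar`, value exceeding f(xstar) by at least -ζ²/(2m) + (m/2)·minAbs², which is more
than ε. It remains to reach f(xstar) + ε with probability 1 - 1/n.

Core routine, for a guess opt ≥ f(xstar): smoothness shows that a failed swap makes every entry of v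
small, and strong convexity of f at x then forces the regularized mass of x off T to be at most
2(1+κ) times that on T (`mass_le_of_no_progress`). Hence the sampled coordinate lies in T with
probability at least 1/(2κ+3), and |Rᶜ| + (2κ+3)|R ∩ T| does not grow in expectation. It starts at
most at (2κ+3)t, so |Rᶜ| exceeds t(4κ+5) with probability at most (2κ+3)/(4κ+5) ≤ 5/9. Otherwise
enough swaps succeed, each shrinking the gap to opt by the factor 1 - 1/s (`coreLoop_failure`).

Repetition lowers the failure probability to 1/(6nL), with L = log((f(0) - B)/(ε/3)), and the
bisection makes at most 6L passes, so a union bound gives 1/n (`arht_failure`). -/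

theorem mem_supp {x : E n} {i : Fin n} : i ∈ supp x ↔ x i ≠ 0 := by simp [supp]

theorem apply_eq_zero_of_supp_subset {x : E n} {S : Finset (Fin n)} (h : supp x ⊆ S) {i : Fin n}
    (hi : i ∉ S) : x i = 0 := by
  by_contra h0
  exact hi (h (mem_supp.2 h0))

theorem supp_subset_iff {x : E n} {S : Finset (Fin n)} : supp x ⊆ S ↔ ∀ i ∉ S, x i = 0 := by
  refine ⟨fun h i hi => apply_eq_zero_of_supp_subset h hi, fun h i hi => ?_⟩
  by_contra hiS
  exact mem_supp.1 hi (h i hiS)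

theorem supp_zero : supp (0 : E n) = ∅ := by
  ext i; simp [mem_supp]

theorem supp_sub_subset {x y : E n} {S T : Finset (Fin n)} (hx : supp x ⊆ S) (hy : supp y ⊆ T) :
    supp (y - x) ⊆ S ∪ T := by
  rw [supp_subset_iff] at *
  intro i hi
  rw [Finset.notMem_union] at hi
  simp [hx i hi.1, hy i hi.2]

theorem norm_sq_eq_sum (x : E n) : ‖x‖ ^ 2 = ∑ i, x i ^ 2 := by
  simp [EuclideanSpace.norm_sq_eq]

theorem inner_eq_sum (x y : E n) : inner ℝ x y = ∑ i, x i * y i := by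
  simp [PiLp.inner_apply, mul_comm]

theorem norm_restrict_sq (x : E n) (R : Finset (Fin n)) :
    ‖restrict x R‖ ^ 2 = ∑ i ∈ R, x i ^ 2 := by
  rw [norm_sq_eq_sum]
  simp [restrict, ite_pow, Finset.sum_ite_mem]

theorem reg_eq (f : E n → ℝ) (R : Finset (Fin n)) (x : E n) :
    reg f R x = f x + rss f 2 / 2 * ∑ i ∈ R, x i ^ 2 := by
  rw [reg, norm_restrict_sq]

theorem reg_zero (f : E n → ℝ) (R : Finset (Fin n)) : reg f R 0 = f 0 := by
  simp [reg_eq]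

/-! ### Attainment of the restricted constants -/

/-- The restricted strong convexity constant is admissible as soon as it is positive. -/
theorem isRSC_rsc {f : E n → ℝ} {k : ℕ} (h : 0 < rsc f k) : IsRSC f k (rsc f k) := by
  -- The real supremum of an empty or unbounded set is `0`, so positivity excludes both cases.
  have hne : {ρ : ℝ | 0 ≤ ρ ∧ IsRSC f k ρ}.Nonempty := by
    by_contra h0
    rw [Set.not_nonempty_iff_eq_empty] at h0
    simp [rsc, h0] at h
  have hb : BddAbove {ρ : ℝ | 0 ≤ ρ ∧ IsRSC f k ρ} := by
    by_contra h0
    rw [rsc, Real.sSup_of_not_bddAbove h0] at h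
    exact lt_irrefl _ h
  have hc : IsClosed {ρ : ℝ | 0 ≤ ρ ∧ IsRSC f k ρ} := by
    simp only [IsRSC, Set.ofPred_and, Set.ofPred_forall]
    refine isClosed_Ici.inter ?_
    refine isClosed_iInter fun x => isClosed_iInter fun y => isClosed_iInter fun _ => ?_
    exact isClosed_le (by fun_prop) (by fun_prop)
  exact (hc.csSup_mem hne hb).2

/-- The restricted smoothness constant is admissible. -/
theorem isRSS_rss {f : E n → ℝ} {k : ℕ} (hne : ∃ ρ, IsRSS f k ρ)
    (hb : BddBelow {ρ : ℝ | IsRSS f k ρ}) : IsRSS f k (rss f k) := by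
  have hc : IsClosed {ρ : ℝ | IsRSS f k ρ} := by
    simp only [IsRSS, Set.ofPred_forall]
    refine isClosed_iInter fun x => isClosed_iInter fun y => isClosed_iInter fun _ => ?_
    exact isClosed_le (by fun_prop) (by fun_prop)
  exact hc.csInf_mem hne hb

/-- Both inequalities are tested on 0 and a unit coordinate vector. This bounds the smoothness
parameters from below and later gives κ ≥ 1. -/
theorem le_of_isRSC_of_isRSS [NeZero n] {f : E n → ℝ} {k l : ℕ} (hk : 1 ≤ k) (hl : 1 ≤ l)
    {a b : ℝ} (ha : IsRSC f k a) (hb : IsRSS f l b) : a ≤ b := by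
  have hc : (supp (EuclideanSpace.single (0 : Fin n) (1 : ℝ) - 0)).card ≤ 1 := by
    refine (Finset.card_le_card (t := {0}) ?_).trans (by simp)
    rw [supp_subset_iff]
    intro i hi
    simp at hi
    simp [hi]
  have h1 := ha 0 (EuclideanSpace.single 0 1) (hc.trans hk)
  have h2 := hb 0 (EuclideanSpace.single 0 1) (hc.trans hl)
  simp at h1 h2
  linarith

theorem rgoc_spec (f : E n → ℝ) (z : E n) (k : ℕ) :
    0 ≤ rgoc f z k ∧ ∀ y : E n, (supp y).card ≤ k → |inner ℝ (∇ f z) y| ≤ rgoc f z k * ‖y‖ := by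
  have hc : IsClosed {ζ : ℝ | 0 ≤ ζ ∧
      ∀ y : E n, (supp y).card ≤ k → |inner ℝ (∇ f z) y| ≤ ζ * ‖y‖} := by
    simp only [Set.ofPred_and, Set.ofPred_forall]
    refine isClosed_Ici.inter ?_
    refine isClosed_iInter fun y => isClosed_iInter fun _ => ?_
    exact isClosed_le (by fun_prop) (by fun_prop)
  exact hc.csInf_mem ⟨‖∇ f z‖, norm_nonneg _, fun y _ => abs_real_inner_le_norm _ _⟩
    ⟨0, fun _ h => h.1⟩

/-! ### The regularized objective and its restricted minimizers -/

/-- The gradient of the regularized objective. -/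
theorem hasGradientAt_reg {f : E n → ℝ} (hf : Differentiable ℝ f) (R : Finset (Fin n)) (x : E n) :
    HasGradientAt (reg f R) (∇ f x + rss f 2 • restrict x R) x := by
  have h1 : HasFDerivAt (fun y : E n => ∑ i ∈ R, y i ^ 2)
      (∑ i ∈ R, (2 * x i) • (EuclideanSpace.proj i : E n →L[ℝ] ℝ)) x := by
    refine HasFDerivAt.fun_sum fun i _ => ?_
    have := ((EuclideanSpace.proj i : E n →L[ℝ] ℝ).hasFDerivAt (x := x)).pow 2
    simpa using this
  have h2 := (hf x).hasGradientAt.hasFDerivAt.add (h1.const_mul (rss f 2 / 2))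
  rw [hasGradientAt_iff_hasFDerivAt]
  have e : reg f R = f + fun y => rss f 2 / 2 * ∑ i ∈ R, y i ^ 2 := by
    ext y; simp [reg_eq]
  rw [e]
  refine h2.congr_fderiv (ContinuousLinearMap.ext (σ₁₂ := RingHom.id ℝ) fun v => ?_)
  simp only [InnerProductSpace.toDual_apply_apply, inner_add_left, real_inner_smul_left,
    add_apply, smul_apply, sum_apply, smul_eq_mul, PiLp.proj_apply]
  congr 1
  simp only [inner_eq_sum, restrict, ite_mul, zero_mul, Finset.sum_ite_mem, Finset.univ_inter,
    Finset.mul_sum]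
  refine Finset.sum_congr rfl fun i _ => by ring

theorem inner_gradient_reg {f : E n → ℝ} (hf : Differentiable ℝ f) (R : Finset (Fin n))
    (x v : E n) :
    inner ℝ (∇ (reg f R) x) v = inner ℝ (∇ f x) v + rss f 2 * ∑ i ∈ R, x i * v i := by
  rw [(hasGradientAt_reg hf R x).gradient, inner_add_left, real_inner_smul_left]
  congr 2
  simp [inner_eq_sum, restrict, ite_mul, Finset.sum_ite_mem]

/-- At a restricted minimizer the gradient vanishes on the support set. -/
theorem IsRestrictedMinimizer.gradient_eq_zero {f : E n → ℝ} (hf : Differentiable ℝ f)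
    {R S : Finset (Fin n)} {x : E n} (hx : IsRestrictedMinimizer (reg f R) S x) {i : Fin n}
    (hi : i ∈ S) : (∇ (reg f R) x) i = 0 := by
  have hg := (hasGradientAt_reg hf R x).differentiableAt.hasGradientAt.hasFDerivAt
  set e : E n := EuclideanSpace.single i 1
  have hl : HasDerivAt (fun t : ℝ => x + t • e) e 0 := by
    simpa using ((hasDerivAt_id (0 : ℝ)).smul_const e).const_add x
  have hc : HasDerivAt (fun t : ℝ => reg f R (x + t • e)) ((∇ (reg f R) x) i) 0 := by
    have hg' : HasFDerivAt (reg f R) (InnerProductSpace.toDual ℝ (E n) (∇ (reg f R) x))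
        (x + (0 : ℝ) • e) := by simpa using hg
    have := hg'.comp_hasDerivAt (0 : ℝ) hl
    rw [InnerProductSpace.toDual_apply_apply, EuclideanSpace.inner_single_right, one_mul,
      conj_trivial] at this
    exact this
  refine IsLocalMin.hasDerivAt_eq_zero (Filter.Eventually.of_forall fun t => ?_) hc
  simp only [zero_smul, add_zero]
  refine hx.2 _ ?_
  rw [supp_subset_iff]
  intro k hk
  have hki : k ≠ i := by rintro rfl; exact hk hi
  simp [e, hki, apply_eq_zero_of_supp_subset hx.1 hk]

/-- Smoothness of the regularized objective along directions with at most two coordinates. -/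
theorem reg_le_of_isRSS {f : E n → ℝ} (hf : Differentiable ℝ f) (hs : IsRSS f 2 (rss f 2))
    (hp : 0 ≤ rss f 2) (R : Finset (Fin n)) {x y : E n} (h : (supp (y - x)).card ≤ 2) :
    reg f R y ≤ reg f R x + inner ℝ (∇ (reg f R) x) (y - x) + rss f 2 * ‖y - x‖ ^ 2 := by
  have h1 := hs x y h
  rw [inner_gradient_reg hf, reg_eq, reg_eq]
  have h2 : ∑ i ∈ R, y i ^ 2 ≤ ∑ i ∈ R, x i ^ 2 + 2 * ∑ i ∈ R, x i * (y - x) i + ‖y - x‖ ^ 2 := by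
    have h3 : ∑ i ∈ R, (y - x) i ^ 2 ≤ ‖y - x‖ ^ 2 := by
      rw [norm_sq_eq_sum]
      exact Finset.sum_le_univ_sum_of_nonneg fun i => sq_nonneg _
    have h4 : ∑ i ∈ R, y i ^ 2 =
        ∑ i ∈ R, x i ^ 2 + 2 * ∑ i ∈ R, x i * (y - x) i + ∑ i ∈ R, (y - x) i ^ 2 := by
      rw [Finset.mul_sum, ← Finset.sum_add_distrib, ← Finset.sum_add_distrib]
      refine Finset.sum_congr rfl fun i _ => ?_
      simp only [PiLp.sub_apply]
      ring
    linarith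
  nlinarith

theorem le_reg {f : E n → ℝ} (hp : 0 ≤ rss f 2) (R : Finset (Fin n)) (x : E n) :
    f x ≤ reg f R x := by
  rw [reg_eq]
  have : 0 ≤ ∑ i ∈ R, x i ^ 2 := Finset.sum_nonneg fun i _ => sq_nonneg _
  nlinarith

theorem reg_mono {f : E n → ℝ} (hp : 0 ≤ rss f 2) {R R' : Finset (Fin n)} (h : R' ⊆ R) (x : E n) :
    reg f R' x ≤ reg f R x := by
  rw [reg_eq, reg_eq]
  have := Finset.sum_le_sum_of_subset_of_nonneg h (f := fun i => x i ^ 2) fun i _ _ => sq_nonneg _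
  nlinarith

theorem reg_empty (f : E n → ℝ) : reg f ∅ = f := by
  ext x; simp [reg_eq]

/-- Restricted minimizers exist on supports on which the objective is strongly convex. -/
theorem exists_isRestrictedMinimizer {f : E n → ℝ} (hf : Differentiable ℝ f) {k : ℕ} {m : ℝ}
    (hm : 0 < m) (hc : IsRSC f k m) (hp : 0 ≤ rss f 2) (R : Finset (Fin n)) {S : Finset (Fin n)}
    (hS : S.card ≤ k) : ∃ x, IsRestrictedMinimizer (reg f R) S x := by
  -- Beyond this radius the quadratic term of strong convexity at 0 beats the linear one, so values
  -- there are at least f(0) and compactness of the ball suffices.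
  set r : ℝ := 2 * ‖∇ f 0‖ / m
  have hr : 0 ≤ r := by positivity
  have hK : IsCompact (Metric.closedBall (0 : E n) r ∩ {x | supp x ⊆ S}) := by
    refine (isCompact_closedBall _ _).inter_right ?_
    simp only [supp_subset_iff, Set.ofPred_forall]
    refine isClosed_iInter fun i => isClosed_iInter fun _ => ?_
    exact isClosed_eq (by fun_prop) (by fun_prop)
  have hcont : Continuous (reg f R) := by
    have : Differentiable ℝ (reg f R) := fun x => (hasGradientAt_reg hf R x).differentiableAt
    exact this.continuous
  have h0 : (0 : E n) ∈ Metric.closedBall (0 : E n) r ∩ {x | supp x ⊆ S} :=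
    ⟨by simpa using hr, by simp [supp_zero]⟩
  obtain ⟨x, hxK, hx⟩ := hK.exists_isMinOn ⟨0, h0⟩ hcont.continuousOn
  refine ⟨x, hxK.2, fun y hy => ?_⟩
  by_cases hyr : ‖y‖ ≤ r
  · exact hx ⟨by simpa using hyr, hy⟩
  · have h1 := hx h0
    simp only [Set.mem_ofPred_eq, reg_zero] at h1
    have h2 := hc 0 y (by simpa using (Finset.card_le_card hy).trans hS)
    simp only [sub_zero] at h2
    have h3 := (abs_le.1 (abs_real_inner_le_norm (∇ f 0) y)).1
    have h4 : 2 * ‖∇ f 0‖ < ‖y‖ * m := (div_lt_iff₀ hm).1 (not_le.1 hyr)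
    have h5 := le_reg hp R y
    have h6 : 0 ≤ ‖y‖ := norm_nonneg y
    nlinarith

theorem isRestrictedMinimizer_argminOn {g : E n → ℝ} {S : Finset (Fin n)}
    (h : ∃ x, IsRestrictedMinimizer g S x) : IsRestrictedMinimizer g S (argminOn g S) := by
  rw [argminOn, dif_pos h]
  exact h.choose_spec

theorem supp_argminOn_subset (g : E n → ℝ) (S : Finset (Fin n)) : supp (argminOn g S) ⊆ S := by
  rw [argminOn]
  split_ifs with h
  · exact h.choose_spec.1
  · simp [supp_zero]

/-! ### Progress of a swap, and consequences of its failure -/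

/-- The decrease of the regularized objective after swapping one coordinate. -/
theorem reg_swap_le {f : E n → ℝ} (hf : Differentiable ℝ f) (hs : IsRSS f 2 (rss f 2))
    (hp : 0 < rss f 2) {R S : Finset (Fin n)} {x x' : E n} {i j : Fin n} (hj : j ∈ S)
    (hx : IsRestrictedMinimizer (reg f R) S x)
    (hx' : IsRestrictedMinimizer (reg f R) ((S ∪ {i}) \ {j}) x') :
    reg f R x' ≤ reg f R x - (∇ (reg f R) x) i ^ 2 / (4 * rss f 2) + rss f 2 * x j ^ 2 := by
  set v := ∇ (reg f R) x with hv
  set p := rss f 2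
  -- Minimizer of η ↦ η·v i + p·η². It vanishes when i ∈ S, which also covers the degenerate case i
  -- = j.
  set η : ℝ := -v i / (2 * p) with hη
  have hη0 : i ∈ S → η = 0 := fun hi => by
    rw [hη, hv, hx.gradient_eq_zero hf hi]; simp
  set w : E n := EuclideanSpace.single i η - EuclideanSpace.single j (x j) with hw
  have hwk : ∀ k, w k = (if k = i then η else 0) - (if k = j then x j else 0) := fun k => by
    simp [hw]
  have h1 : supp (x + w) ⊆ (S ∪ {i}) \ {j} := by
    rw [supp_subset_iff]
    intro k hk
    rw [PiLp.add_apply, hwk]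
    by_cases hkj : k = j
    · subst hkj
      by_cases hki : k = i
      · subst hki; simp [hη0 hj]
      · simp [hki]
    · have hk' : k ∉ S ∧ k ≠ i := by simpa [hkj, and_comm] using hk
      simp [hkj, hk'.2, apply_eq_zero_of_supp_subset hx.1 hk'.1]
  have h2 : (supp (x + w - x)).card ≤ 2 := by
    refine (Finset.card_le_card (t := {i, j}) ?_).trans Finset.card_le_two
    rw [supp_subset_iff]
    intro k hk
    simp only [Finset.mem_insert, Finset.mem_singleton, not_or] at hk
    rw [add_sub_cancel_left, hwk]
    simp [hk.1, hk.2]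
  have h3 := reg_le_of_isRSS hf hs hp.le R h2
  have h4 : inner ℝ v w = η * v i := by
    rw [hw, inner_sub_right, EuclideanSpace.inner_single_right, EuclideanSpace.inner_single_right]
    simp [hv, hx.gradient_eq_zero hf hj]
  have h5 : ‖w‖ ^ 2 = η ^ 2 + x j ^ 2 := by
    rw [hw, norm_sub_sq_real, EuclideanSpace.inner_single_right]
    by_cases hij : i = j
    · simp [hη0 (hij ▸ hj)]
    · simp [Ne.symm hij]
  rw [add_sub_cancel_left, h4, h5] at h3
  refine ((hx'.2 _ h1).trans h3).trans (le_of_eq ?_)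
  rw [hη]
  field_simp
  ring

/-- Strong convexity of `f` at a minimizer of the regularized objective, compared with a sparse
vector. -/
theorem IsRestrictedMinimizer.sub_le_of_isRSC {f : E n → ℝ} (hf : Differentiable ℝ f) {s t : ℕ}
    {m : ℝ} (hm : 0 < m) (hc : IsRSC f (s + t) m) {xstar : E n} (hsparse : (supp xstar).card ≤ t)
    {R S : Finset (Fin n)} {x : E n} (hS : S.card ≤ s)
    (hx : IsRestrictedMinimizer (reg f R) S x) :
    f x - (∑ k ∈ supp xstar \ S, (∇ (reg f R) x) k ^ 2) / (2 * m)
      - rss f 2 ^ 2 / (2 * m) * ∑ k ∈ R ∩ supp xstar, x k ^ 2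
      + rss f 2 * ∑ k ∈ R \ supp xstar, x k ^ 2 ≤ f xstar := by
  set v := ∇ (reg f R) x with hv
  set p := rss f 2
  set T := supp xstar with hT
  have h1 : (supp (xstar - x)).card ≤ s + t :=
    (Finset.card_le_card (supp_sub_subset hx.1 (Finset.Subset.refl T))).trans
      ((Finset.card_union_le _ _).trans (by omega))
  have h2 := hc x xstar h1
  have h3 := inner_gradient_reg hf R x (xstar - x)
  set w := xstar - x with hw
  -- Coordinatewise completion of squares. On T \ S, x vanishes; on T ∩ S, v vanishes; off T, w = -x
  -- and v·x = 0, so the regularizer contributes +p·x² on R.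
  have h4 : -((∑ k ∈ T \ S, v k ^ 2) / (2 * m)) - p ^ 2 / (2 * m) * ∑ k ∈ R ∩ T, x k ^ 2
        + p * ∑ k ∈ R \ T, x k ^ 2 ≤
      inner ℝ v w - p * ∑ k ∈ R, x k * w k + m / 2 * ‖w‖ ^ 2 := by
    rw [norm_sq_eq_sum, inner_eq_sum]
    have e1 : ∀ (A : Finset (Fin n)) (g : Fin n → ℝ),
        ∑ k ∈ A, g k = ∑ k, if k ∈ A then g k else 0 := fun A g => by simp
    rw [e1 (T \ S), e1 (R ∩ T), e1 (R \ T), e1 R, Finset.sum_div, Finset.mul_sum,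
      Finset.mul_sum, Finset.mul_sum, Finset.mul_sum, ← Finset.sum_neg_distrib,
      ← Finset.sum_sub_distrib, ← Finset.sum_add_distrib, ← Finset.sum_sub_distrib,
      ← Finset.sum_add_distrib]
    refine Finset.sum_le_sum fun k _ => ?_
    simp only [Finset.mem_sdiff, Finset.mem_inter]
    by_cases hkT : k ∈ T
    · by_cases hkS : k ∈ S
      · have hvk : v k = 0 := hx.gradient_eq_zero hf hkS
        by_cases hkR : k ∈ R
        · simp only [hkT, hkS, hkR, hvk, not_true, and_false, and_true, if_true, if_false,
            zero_div, neg_zero, mul_zero, zero_mul, zero_sub, add_zero]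
          have : 0 ≤ (m * w k - p * x k) ^ 2 / (2 * m) := by positivity
          have e : (m * w k - p * x k) ^ 2 / (2 * m) =
            m / 2 * w k ^ 2 - p * (x k * w k) + p ^ 2 / (2 * m) * x k ^ 2 := by
            field_simp; ring
          linarith
        · simp [hkT, hkS, hkR, hvk]
          positivity
      · have hxk : x k = 0 := apply_eq_zero_of_supp_subset hx.1 hkS
        simp only [hkT, hkS, hxk, not_true, not_false_eq_true, and_true, and_false, if_true]
        have : 0 ≤ (m * w k + v k) ^ 2 / (2 * m) := by positivity
        have e : (m * w k + v k) ^ 2 / (2 * m) =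
          m / 2 * w k ^ 2 + v k * w k + v k ^ 2 / (2 * m) := by
          field_simp; ring
        simp
        linarith
    · have hwk : w k = -x k := by
        have : xstar k = 0 := apply_eq_zero_of_supp_subset (Finset.Subset.refl _) hkT
        simp [hw, this]
      have hvx : v k * x k = 0 := by
        by_cases hkS : k ∈ S
        · rw [hv, hx.gradient_eq_zero hf hkS, zero_mul]
        · rw [apply_eq_zero_of_supp_subset hx.1 hkS, mul_zero]
      have hmx : 0 ≤ m / 2 * x k ^ 2 := by positivity
      by_cases hkR : k ∈ R
      · simp only [hkT, hkR, hwk, not_false_eq_true, and_true, and_false, false_and, if_true,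
          if_false, zero_div, neg_zero, mul_zero, zero_sub, zero_add]
        nlinarith
      · simp only [hkT, hkR, hwk, not_false_eq_true, and_false, false_and,
          if_false, zero_div, neg_zero, mul_zero, sub_zero]
        nlinarith
  linarith

/-- If a swap makes insufficient progress, the regularized mass of `x` inside the support of
`xstar` dominates a fixed fraction of the mass outside. -/
theorem mass_le_of_no_progress {f : E n → ℝ} (hf : Differentiable ℝ f)
    (hsm : IsRSS f 2 (rss f 2)) (hp : 0 < rss f 2) {s t : ℕ} {m κ : ℝ} (hm : 0 < m)
    (hc : IsRSC f (s + t) m) (hκ : rss f 2 = κ * m) (σ : SelectionRule n)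
    {xstar : E n} (hsparse : (supp xstar).card ≤ t) (ht : 0 < t)
    (hst : (t : ℝ) * (12 * κ + 6) ≤ s) {opt : ℝ} (hopt : f xstar ≤ opt)
    {R S : Finset (Fin n)} {x x' : E n} (hS : S.card = s)
    (hR : (Rᶜ.card : ℝ) ≤ t * (4 * κ + 5))
    (hx : IsRestrictedMinimizer (reg f R) S x)
    (hx' : IsRestrictedMinimizer (reg f R)
      ((S ∪ {σ.argmax (∇ (reg f R) x)}) \ {σ.argmin S x}) x')
    (hpos : opt < reg f R x)
    (hfail : reg f R x - reg f R x' < 1 / (s : ℝ) * (reg f R x - opt)) :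
    0 < ∑ i ∈ R ∩ supp xstar, x i ^ 2 ∧
    ∑ i ∈ R \ supp xstar, x i ^ 2 ≤ 2 * (1 + κ) * ∑ i ∈ R ∩ supp xstar, x i ^ 2 := by
  set v := ∇ (reg f R) x with hv
  set p := rss f 2
  set i := σ.argmax v
  set j := σ.argmin S x
  set T := supp xstar with hT
  set Y := ∑ i ∈ R ∩ T, x i ^ 2 with hY
  set Z := ∑ i ∈ R \ T, x i ^ 2 with hZ
  have hκ0 : 0 < κ := pos_of_mul_pos_left (hκ ▸ hp) hm.le
  have ht' : (0 : ℝ) < t := by exact_mod_cast ht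
  have hs0 : (0 : ℝ) < s := lt_of_lt_of_le (by positivity) hst
  have hSne : S.Nonempty := by
    rw [← Finset.card_pos, hS]; exact_mod_cast hs0
  have hdec := reg_swap_le hf hsm hp (σ.argmin_mem S x hSne) hx hx'
  have hZ0 : 0 ≤ Z := Finset.sum_nonneg fun _ _ => sq_nonneg _
  -- At least t(12κ+6) - t(4κ+5) - t = 8κt coordinates lie in (S ∩ R) \ T, and x j is smallest in
  -- magnitude among those of S.
  have hxj : 8 * κ * t * x j ^ 2 ≤ Z := by
    have h1 : (S.card : ℝ) ≤ ((S ∩ R) \ T).card + Rᶜ.card + T.card := by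
      have : S ⊆ ((S ∩ R) \ T) ∪ Rᶜ ∪ T := by
        intro k hk
        simp only [Finset.mem_union, Finset.mem_sdiff, Finset.mem_inter, Finset.mem_compl]
        tauto
      have h := (Finset.card_le_card this).trans ((Finset.card_union_le _ _).trans
        (Nat.add_le_add_right (Finset.card_union_le _ _) _))
      exact_mod_cast h
    have h2 : (T.card : ℝ) ≤ t := by exact_mod_cast hsparse
    have h3 : 8 * κ * t ≤ ((S ∩ R) \ T).card := by
      rw [hS] at h1; linarith
    calc 8 * κ * t * x j ^ 2 ≤ ((S ∩ R) \ T).card * x j ^ 2 := by gcongr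
      _ = ∑ k ∈ (S ∩ R) \ T, x j ^ 2 := by simp
      _ ≤ ∑ k ∈ (S ∩ R) \ T, x k ^ 2 := by
        refine Finset.sum_le_sum fun k hk => sq_le_sq.2 (σ.argmin_spec S x k ?_)
        simp at hk; exact hk.1.1
      _ ≤ Z := Finset.sum_le_sum_of_subset_of_nonneg
        (Finset.sdiff_subset_sdiff Finset.inter_subset_right le_rfl) fun _ _ _ => sq_nonneg _
  set G := ∑ k ∈ T \ S, v k ^ 2 with hG
  have hGle : G ≤ t * v i ^ 2 := by
    calc G ≤ ∑ k ∈ T \ S, v i ^ 2 := Finset.sum_le_sum fun k _ => sq_le_sq.2 (σ.argmax_spec v k)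
      _ = (T \ S).card * v i ^ 2 := by simp
      _ ≤ t * v i ^ 2 := by
        have : ((T \ S).card : ℝ) ≤ t := by
          exact_mod_cast (Finset.card_le_card Finset.sdiff_subset).trans hsparse
        gcongr
  have hsplit : ∑ k ∈ R, x k ^ 2 = Y + Z := by
    rw [hY, hZ, Finset.sum_inter_add_sum_sdiff]
  have hconv := (hx.sub_le_of_isRSC hf hm hc hsparse hS.le).trans hopt
  have hreg : reg f R x = f x + p / 2 * (Y + Z) := by rw [reg_eq, hsplit]
  set Δ := reg f R x - opt with hΔ
  have hΔ0 : 0 < Δ := by rw [hΔ]; linarith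
  -- The failed swap turned around: its guaranteed decrease is below Δ/s.
  have hv2 : v i ^ 2 ≤ 4 * p * (Δ / s + p * x j ^ 2) := by
    have h : v i ^ 2 / (4 * p) ≤ Δ / s + p * x j ^ 2 := by
      rw [one_div_mul_eq_div] at hfail
      linarith
    rwa [div_le_iff₀ (by positivity), mul_comm] at h
  have hG2 : G / (2 * m) ≤ 2 * κ * t * (Δ / s) + p / 4 * Z := by
    have h1 : G ≤ t * (4 * p * (Δ / s + p * x j ^ 2)) :=
      hGle.trans (mul_le_mul_of_nonneg_left hv2 ht'.le)
    calc G / (2 * m) ≤ t * (4 * p * (Δ / s + p * x j ^ 2)) / (2 * m) := by gcongr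
      _ = 2 * κ * t * (Δ / s) + p / 4 * (8 * κ * t * x j ^ 2) := by
        rw [hκ]; field_simp; ring
      _ ≤ _ := by gcongr
  have hhalf : 2 * κ * t * (Δ / s) ≤ Δ / 2 := by
    have : 2 * κ * t / s ≤ 1 / 2 := by
      rw [div_le_iff₀ hs0]; linarith [mul_pos ht' hκ0]
    calc 2 * κ * t * (Δ / s) = 2 * κ * t / s * Δ := by ring
      _ ≤ 1 / 2 * Δ := by gcongr
      _ = Δ / 2 := by ring
  have hpm : p ^ 2 / (2 * m) = p * κ / 2 := by
    rw [hκ]; field_simp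
  rw [hpm] at hconv
  -- What remains is Δ/2 + pZ/4 ≤ p(1+κ)Y/2; strictness comes from Δ > 0.
  have hfin : 0 < p * (2 * (1 + κ) * Y - Z) := by linarith
  have hfin' : 0 < 2 * (1 + κ) * Y - Z := pos_of_mul_pos_right hfin hp.le
  exact ⟨pos_of_mul_pos_right (a := 2 * (1 + κ)) (by linarith) (by positivity), by linarith⟩

/-! ### Probability estimates -/

theorem toOuterMeasure_univ {α : Type*} (p : PMF α) : p.toOuterMeasure Set.univ = 1 :=
  (p.toOuterMeasure_apply_eq_one_iff _).2 (Set.subset_univ _)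

theorem toOuterMeasure_le_one {α : Type*} (p : PMF α) (A : Set α) : p.toOuterMeasure A ≤ 1 :=
  (MeasureTheory.measure_mono (Set.subset_univ A)).trans (toOuterMeasure_univ p).le

theorem toOuterMeasure_pure_of_notMem {α : Type*} {a : α} {A : Set α} (h : a ∉ A) :
    (PMF.pure a).toOuterMeasure A = 0 := by
  classical
  simp [PMF.toOuterMeasure_pure_apply, h]

/-- Law of total probability, as an upper bound with one exceptional event. -/
theorem toOuterMeasure_bind_le {α β : Type*} (p : PMF α) (g : α → PMF β) (A : Set β) (C : Set α)
    {u v : ENNReal} (hu : ∀ a ∈ C, (g a).toOuterMeasure A ≤ u)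
    (hv : ∀ a ∉ C, (g a).toOuterMeasure A ≤ v) :
    (p.bind g).toOuterMeasure A ≤ p.toOuterMeasure C * u + v := by
  classical
  rw [PMF.toOuterMeasure_bind_apply, PMF.toOuterMeasure_apply, ← ENNReal.tsum_mul_right]
  calc ∑' a, p a * (g a).toOuterMeasure A
      ≤ ∑' a, (C.indicator p a * u + p a * v) := by
        refine ENNReal.tsum_le_tsum fun a => ?_
        by_cases ha : a ∈ C
        · rw [Set.indicator_of_mem ha]
          exact (mul_le_mul_right (hu a ha) _).trans le_self_add
        · rw [Set.indicator_of_notMem ha, zero_mul, zero_add]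
          exact mul_le_mul_right (hv a ha) _
    _ = _ := by rw [ENNReal.tsum_add, ENNReal.tsum_mul_right (a := v), p.tsum_coe, one_mul]

/-- The effect of one random unregularization step. -/
theorem toOuterMeasure_unregularize_bind_le {β : Type*} {R T : Finset (Fin n)} {x : E n}
    (h0 : 0 < ∑ i ∈ R, x i ^ 2) (g : Finset (Fin n) → PMF β) (A : Set β) {u v : ℝ} (hu0 : 0 ≤ u)
    (hv0 : 0 ≤ v)
    (hu : ∀ i ∈ R ∩ T, (g (R.erase i)).toOuterMeasure A ≤ ENNReal.ofReal u)
    (hv : ∀ i ∈ R \ T, (g (R.erase i)).toOuterMeasure A ≤ ENNReal.ofReal v) :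
    ((unregularize R x).bind g).toOuterMeasure A ≤ ENNReal.ofReal
      (((∑ i ∈ R ∩ T, x i ^ 2) * u + (∑ i ∈ R \ T, x i ^ 2) * v) / ∑ i ∈ R, x i ^ 2) := by
  classical
  set W := ∑ i ∈ R, x i ^ 2 with hW
  have hw : ∑' i, weight R x i = ENNReal.ofReal W := by
    rw [tsum_fintype, hW, ENNReal.ofReal_sum_of_nonneg fun i _ => sq_nonneg _]
    simp [weight, Finset.sum_ite_mem]
  have hne : ∑' i, weight R x i ≠ 0 := by
    rw [hw]; simpa using h0
  rw [unregularize, dif_pos hne, PMF.bind_map, PMF.toOuterMeasure_bind_apply, tsum_fintype]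
  have hle : ∀ i, PMF.normalize (weight R x) hne (tsum_weight_ne_top R x) i *
      ((g ∘ fun i => R.erase i) i).toOuterMeasure A ≤
      ENNReal.ofReal ((if i ∈ R ∩ T then x i ^ 2 else 0) * u / W +
        (if i ∈ R \ T then x i ^ 2 else 0) * v / W) := by
    intro i
    rw [PMF.normalize_apply, hw, ← ENNReal.ofReal_inv_of_pos h0, weight]
    by_cases hR : i ∈ R
    · by_cases hT : i ∈ T
      · have h1 : i ∈ R ∩ T := by simp [hR, hT]
        have h2 : i ∉ R \ T := by simp [hT]
        simp only [hR, h1, h2, if_true, if_false, zero_mul, zero_div, add_zero]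
        refine (mul_le_mul_right (hu i h1) _).trans (le_of_eq ?_)
        rw [← ENNReal.ofReal_mul (sq_nonneg _), ← ENNReal.ofReal_mul (by positivity)]
        congr 1; ring
      · have h1 : i ∉ R ∩ T := by simp [hT]
        have h2 : i ∈ R \ T := by simp [hR, hT]
        simp only [hR, h1, h2, if_true, if_false, zero_mul, zero_div, zero_add]
        refine (mul_le_mul_right (hv i h2) _).trans (le_of_eq ?_)
        rw [← ENNReal.ofReal_mul (sq_nonneg _), ← ENNReal.ofReal_mul (by positivity)]
        congr 1; ring
    · simp [hR]
  refine (Finset.sum_le_sum fun i _ => hle i).trans (le_of_eq ?_)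
  rw [← ENNReal.ofReal_sum_of_nonneg]
  · congr 1
    rw [Finset.sum_add_distrib, ← Finset.sum_div, ← Finset.sum_div, ← Finset.sum_mul,
      ← Finset.sum_mul, Finset.sum_ite_mem, Finset.sum_ite_mem, Finset.univ_inter,
      Finset.univ_inter, add_div]
  · intro i _
    split_ifs <;> positivity

/-! ### The core routine -/

theorem card_swap_le {s : ℕ} (hs : 1 ≤ s) (σ : SelectionRule n) {S : Finset (Fin n)}
    (hS : S.card ≤ s) (i : Fin n) (x : E n) : ((S ∪ {i}) \ {σ.argmin S x}).card ≤ s := by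
  rcases S.eq_empty_or_nonempty with rfl | h
  · exact (Finset.card_le_card Finset.sdiff_subset).trans (by simpa using hs)
  · have h3 := Finset.card_union_le S {i}
    rw [Finset.card_sdiff_of_subset (by simp [σ.argmin_mem S x h])]
    simp only [Finset.card_singleton] at h3 ⊢
    omega

/-- Failure probability of the main loop. The bound is a supermartingale: it counts the
unregularized coordinates and the coordinates of the target support still regularized. -/
theorem coreLoop_failure {f : E n → ℝ} (hf : Differentiable ℝ f)
    (hsm : IsRSS f 2 (rss f 2)) (hp : 0 < rss f 2) {s t : ℕ} {m κ : ℝ} (hm : 0 < m)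
    (hc : IsRSC f (s + t) m) (hκ : rss f 2 = κ * m) (σ : SelectionRule n)
    {xstar : E n} (hsparse : (supp xstar).card ≤ t) (ht : 0 < t)
    (hst : (t : ℝ) * (12 * κ + 6) ≤ s) {opt ε : ℝ} (hε : 0 < ε) (hopt : f xstar ≤ opt)
    (k : ℕ) (S R : Finset (Fin n)) (x : E n) (hS : S.card = s ∨ S = Finset.univ ∧ n ≤ s)
    (hx : IsRestrictedMinimizer (reg f R) S x)
    (hval : reg f R x - opt ≤
      ε * Real.exp ((k + (Rᶜ.card : ℝ) - t * (4 * κ + 5)) / s)) :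
    (coreLoop f σ s opt k S R x).toOuterMeasure {y | opt + ε < f y} ≤
      ENNReal.ofReal ((Rᶜ.card + (2 * κ + 3) * (R ∩ supp xstar).card) / (t * (4 * κ + 5))) := by
  have hκ0 : 0 < κ := pos_of_mul_pos_left (hκ ▸ hp) hm.le
  have ht' : (0 : ℝ) < t := by exact_mod_cast ht
  have hs0 : (0 : ℝ) < s := lt_of_lt_of_le (by positivity) hst
  -- Budget of unregularization steps. Once |Rᶜ| exceeds M the claimed bound is at least 1, hence
  -- trivial.
  set M : ℝ := t * (4 * κ + 5) with hM
  have hM0 : 0 < M := by positivity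
  have hex : ∀ (R S : Finset (Fin n)), S.card ≤ s → ∃ x, IsRestrictedMinimizer (reg f R) S x :=
    fun R S hS => exists_isRestrictedMinimizer hf hm hc hp.le R (hS.trans (Nat.le_add_right _ _))
  induction k generalizing S R x with
  | zero =>
    by_cases hR : (Rᶜ.card : ℝ) ≤ M
    · rw [coreLoop, toOuterMeasure_pure_of_notMem]
      · exact zero_le
      · simp only [Set.mem_ofPred_eq, not_lt]
        have h1 : Real.exp (((0 : ℕ) + (Rᶜ.card : ℝ) - M) / s) ≤ 1 := by
          rw [Real.exp_le_one_iff]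
          exact div_nonpos_of_nonpos_of_nonneg (by push_cast; linarith) hs0.le
        have h2 := le_reg hp.le R x
        have h3 := mul_le_mul_of_nonneg_left h1 hε.le
        linarith
    · refine (toOuterMeasure_le_one _ _).trans ?_
      rw [ENNReal.one_le_ofReal, one_le_div hM0]
      have : 0 ≤ (2 * κ + 3) * ((R ∩ supp xstar).card : ℝ) := by positivity
      linarith
  | succ k ih =>
    by_cases hR : (Rᶜ.card : ℝ) ≤ M
    swap
    · refine (toOuterMeasure_le_one _ _).trans ?_
      rw [ENNReal.one_le_ofReal, one_le_div hM0]
      have : 0 ≤ (2 * κ + 3) * ((R ∩ supp xstar).card : ℝ) := by positivity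
      linarith
    have hSs : S.card ≤ s := by
      rcases hS with h | ⟨h, hn⟩
      · exact h.le
      · simpa [h] using hn
    have hmin : IsRestrictedMinimizer f S (argminOn f S) := by
      have := hex ∅ S hSs
      rw [reg_empty] at this
      exact isRestrictedMinimizer_argminOn this
    rw [coreLoop]
    dsimp only
    split_ifs with h1 h2
    · rw [toOuterMeasure_pure_of_notMem]
      · exact zero_le
      · simp only [Set.mem_ofPred_eq, not_lt]
        linarith
    all_goals
      have hpos : opt < reg f R x :=
        (not_le.1 h1).trans_le ((hmin.2 x hx.1).trans (le_reg hp.le R x))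
      -- With S = univ the unregularized minimizer already has value at most f(xstar) ≤ opt, so the
      -- loop would have returned.
      have hScard : S.card = s := by
        rcases hS with h | ⟨h, hn⟩
        · exact h
        · exact absurd ((hmin.2 xstar (by simp [h])).trans hopt) h1
      have hSne : S.Nonempty := by
        rw [← Finset.card_pos, hScard]; exact_mod_cast hs0
      have hjS := σ.argmin_mem S x hSne
      set i := σ.argmax (∇ (reg f R) x) with hi
      set j := σ.argmin S x with hj
      have hS'card : ((S ∪ {i}) \ {j}).card ≤ s :=
        card_swap_le (by exact_mod_cast hs0) σ hSs i x
      have hx' := isRestrictedMinimizer_argminOn (hex R _ hS'card)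
      set x' := argminOn (reg f R) ((S ∪ {i}) \ {j}) with hx'def
    · obtain ⟨hY0, hZ⟩ := mass_le_of_no_progress hf hsm hp hm hc hκ σ hsparse ht hst hopt hScard
        hR hx hx' hpos h2
      have hsplit := Finset.sum_inter_add_sum_sdiff R (supp xstar) fun i => x i ^ 2
      have hZ0 : 0 ≤ ∑ i ∈ R \ supp xstar, x i ^ 2 := Finset.sum_nonneg fun _ _ => sq_nonneg _
      set T := supp xstar with hT
      set Y := ∑ i ∈ R ∩ T, x i ^ 2 with hY
      set Z := ∑ i ∈ R \ T, x i ^ 2 with hZdef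
      have hrec : ∀ i ∈ R, (coreLoop f σ s opt k S (R.erase i)
          (argminOn (reg f (R.erase i)) S)).toOuterMeasure {y | opt + ε < f y} ≤
          ENNReal.ofReal ((Rᶜ.card + 1 + (2 * κ + 3) * ((R.erase i) ∩ T).card) / M) := by
        intro i hi
        have hm' := isRestrictedMinimizer_argminOn (hex (R.erase i) S hSs)
        have hcard : ((R.erase i)ᶜ.card : ℝ) = Rᶜ.card + 1 := by
          rw [Finset.compl_erase, Finset.card_insert_of_notMem (by simpa using hi)]
          push_cast; rfl
        -- Here k drops by one and |Rᶜ| rises by one, so the exponent is unchanged; removing a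
        -- regularizer term cannot raise the minimum.
        have h3 := ih S (R.erase i) _ hS hm' (by
          have h4 := (hm'.2 x hx.1).trans (reg_mono hp.le (R.erase_subset i) x)
          rw [hcard]
          push_cast at hval
          have e : (k : ℝ) + (Rᶜ.card + 1) - M = k + 1 + Rᶜ.card - M := by ring
          rw [e]
          linarith)
        rwa [hcard] at h3
      have hRT : ∀ i ∈ R ∩ T, (((R.erase i) ∩ T).card : ℝ) = (R ∩ T).card - 1 := by
        intro i hi
        rw [Finset.erase_inter, Finset.card_erase_of_mem hi,
          Nat.cast_sub (Finset.card_pos.2 ⟨i, hi⟩)]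
        simp
      have hRT1 : (1 : ℝ) ≤ (R ∩ T).card := by
        have : (R ∩ T).Nonempty := by
          by_contra h0
          rw [Finset.not_nonempty_iff_eq_empty] at h0
          simp [hY, h0] at hY0
        exact_mod_cast Finset.card_pos.2 this
      refine (toOuterMeasure_unregularize_bind_le (T := T) (by linarith) _ _
        (u := (Rᶜ.card + 1 + (2 * κ + 3) * ((R ∩ T).card - 1)) / M)
        (v := (Rᶜ.card + 1 + (2 * κ + 3) * (R ∩ T).card) / M) ?_ (by positivity) ?_ ?_).trans ?_
      · have : 0 ≤ ((R ∩ T).card : ℝ) - 1 := by linarith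
        positivity
      · intro i hi
        rw [← hRT i hi]
        exact hrec i (Finset.mem_inter.1 hi).1
      · intro i hi
        have h3 := hrec i (Finset.mem_sdiff.1 hi).1
        rwa [Finset.erase_inter, Finset.erase_eq_of_notMem (a := i) (s := R ∩ T)
          fun h => (Finset.mem_sdiff.1 hi).2 (Finset.mem_inter.1 h).2] at h3
      · refine ENNReal.ofReal_le_ofReal ?_
        rw [← hsplit, ← hY, ← hZdef, div_le_iff₀ (by linarith), mul_div_assoc', mul_div_assoc',
          ← add_div, div_mul_eq_mul_div]
        refine div_le_div_of_nonneg_right ?_ hM0.le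
        -- The drift is nonpositive: Y + Z ≤ (2κ+3)Y is exactly the mass bound.
        linarith
    · have hprog := not_lt.1 h2
      have hΔ : 0 < 1 / (s : ℝ) * (reg f R x - opt) := mul_pos (by positivity) (by linarith)
      -- If i were in S, the new support would lie in S, and x' could not improve on x.
      have hiS : i ∉ S := by
        intro hiS
        have h3 := hx.2 x' (hx'.1.trans (by
          intro k hk
          simp only [Finset.mem_sdiff, Finset.mem_union, Finset.mem_singleton] at hk
          rcases hk.1 with h | h
          · exact h
          · exact h ▸ hiS))
        linarith
      have hS' : ((S ∪ {i}) \ {j}).card = s := by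
        have h3 : (S ∪ {i}).card = S.card + 1 := by
          rw [Finset.card_union_of_disjoint (by simpa using hiS), Finset.card_singleton]
        rw [Finset.card_sdiff_of_subset (by simp [hjS]), h3, hScard]
        simp
      refine ih _ R x' (Or.inl hS') hx' ?_
      have h3 : 1 - 1 / (s : ℝ) ≤ Real.exp (-(1 / s)) := by
        have := Real.add_one_le_exp (-(1 / (s : ℝ)))
        linarith
      calc reg f R x' - opt ≤ (1 - 1 / (s : ℝ)) * (reg f R x - opt) := by linarith
        _ ≤ Real.exp (-(1 / s)) * (reg f R x - opt) :=
          mul_le_mul_of_nonneg_right h3 (by linarith)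
        _ ≤ Real.exp (-(1 / s)) *
            (ε * Real.exp (((k + 1 : ℕ) + (Rᶜ.card : ℝ) - M) / s)) :=
          mul_le_mul_of_nonneg_left hval (Real.exp_pos _).le
        _ = ε * Real.exp ((k + (Rᶜ.card : ℝ) - M) / s) := by
          rw [mul_left_comm, ← Real.exp_add]
          congr 2
          push_cast
          field_simp
          ring

theorem card_initial (s : ℕ) :
    (Finset.univ.filter fun i : Fin n => (i : ℕ) < s).card = min n s := by
  rw [Fin.card_filter_val_lt]

/-- The core routine fails with probability at most `5 / 9`. -/
theorem core_failure {f : E n → ℝ} (hf : Differentiable ℝ f)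
    (hsm : IsRSS f 2 (rss f 2)) (hp : 0 < rss f 2) {s t : ℕ} {m κ : ℝ} (hm : 0 < m)
    (hc : IsRSC f (s + t) m) (hκ : rss f 2 = κ * m) (hκ1 : 1 ≤ κ) (σ : SelectionRule n)
    {xstar : E n} (hsparse : (supp xstar).card ≤ t) (ht : 0 < t)
    (hst : (t : ℝ) * (12 * κ + 6) ≤ s) {opt ε : ℝ} (hε : 0 < ε) (hopt : f xstar ≤ opt)
    (hB : ⨅ x, f x ≤ opt) (h0 : 0 < f 0 - ⨅ x, f x)
    (hL : 1 ≤ Real.log ((f 0 - ⨅ x, f x) / ε)) :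
    (core f σ s opt ε).toOuterMeasure {y | opt + ε < f y} ≤ ENNReal.ofReal (5 / 9) := by
  have ht' : (0 : ℝ) < t := by exact_mod_cast ht
  have hs0 : (0 : ℝ) < s := lt_of_lt_of_le (by positivity) hst
  have hcard := card_initial (n := n) s
  set S₀ : Finset (Fin n) := Finset.univ.filter fun i : Fin n => (i : ℕ) < s with hS₀
  have hS₀s : S₀.card ≤ s := hcard.le.trans (min_le_right _ _)
  have hx := isRestrictedMinimizer_argminOn (exists_isRestrictedMinimizer hf hm hc hp.le
    Finset.univ (S := S₀) (hS₀s.trans (Nat.le_add_right _ _)))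
  refine (coreLoop_failure hf hsm hp hm hc hκ σ hsparse ht hst hε hopt _ S₀ Finset.univ _ ?_ hx
    ?_).trans ?_
  · rcases le_total n s with h | h
    · refine Or.inr ⟨?_, h⟩
      rw [← Finset.card_eq_iff_eq_univ, hcard, min_eq_left h, Fintype.card_fin]
    · exact Or.inl (hcard.trans (min_eq_right h))
  · have h1 := hx.2 0 (by simp [supp_zero])
    rw [reg_zero] at h1
    set L := Real.log ((f 0 - ⨅ x, f x) / ε) with hLdef
    have h2 : f 0 - ⨅ x, f x = ε * Real.exp L := by
      rw [hLdef, Real.exp_log (by positivity)]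
      field_simp
    have h3 : Real.exp L ≤ Real.exp (((⌈2 * (s : ℝ) * L⌉₊ : ℝ) +
        ((Finset.univᶜ : Finset (Fin n)).card : ℝ) - t * (4 * κ + 5)) / s) := by
      rw [Real.exp_le_exp, le_div_iff₀ hs0]
      have h4 := Nat.le_ceil (2 * (s : ℝ) * L)
      -- Thus M ≤ s ≤ sL: half of the 2sL iterations pays for M and the other half for the initial
      -- gap.
      have h5 : (t : ℝ) * (4 * κ + 5) ≤ t * (12 * κ + 6) :=
        mul_le_mul_of_nonneg_left (by linarith) ht'.le
      have h6 : (s : ℝ) * 1 ≤ s * L := mul_le_mul_of_nonneg_left hL hs0.le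
      simp only [Finset.compl_univ, Finset.card_empty, Nat.cast_zero]
      linarith
    have h4 := mul_le_mul_of_nonneg_left h3 hε.le
    linarith
  · refine ENNReal.ofReal_le_ofReal ?_
    have h1 : ((supp xstar).card : ℝ) ≤ t := by exact_mod_cast hsparse
    simp only [Finset.compl_univ, Finset.card_empty, Nat.cast_zero, Finset.univ_inter, zero_add]
    rw [div_le_iff₀ (by positivity)]
    calc (2 * κ + 3) * ((supp xstar).card : ℝ) ≤ (2 * κ + 3) * t := by gcongr
      -- Equality holds at κ = 1, the worst case.
      _ ≤ (5 / 9 * (4 * κ + 5)) * t := mul_le_mul_of_nonneg_right (by linarith) ht'.le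
      _ = _ := by ring

theorem card_supp_of_mem_support_coreLoop {f : E n → ℝ} {σ : SelectionRule n} {s : ℕ}
    (hs : 1 ≤ s) {opt : ℝ} (k : ℕ) (S R : Finset (Fin n)) (x : E n) (hS : S.card ≤ s)
    (hx : supp x ⊆ S) {y : E n} (hy : y ∈ (coreLoop f σ s opt k S R x).support) :
    (supp y).card ≤ s := by
  induction k generalizing S R x with
  | zero =>
    rw [coreLoop, PMF.mem_support_pure_iff] at hy
    exact hy ▸ (Finset.card_le_card hx).trans hS
  | succ k ih =>
    rw [coreLoop] at hy
    dsimp only at hy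
    split_ifs at hy
    · rw [PMF.mem_support_pure_iff] at hy
      exact hy ▸ (Finset.card_le_card (supp_argminOn_subset _ _)).trans hS
    · obtain ⟨R', -, hy⟩ := (PMF.mem_support_bind_iff _ _ _).1 hy
      exact ih S R' _ hS (supp_argminOn_subset _ _) hy
    · exact ih _ R _ (card_swap_le hs σ hS _ _) (supp_argminOn_subset _ _) hy

theorem card_supp_of_mem_support_core {f : E n → ℝ} {σ : SelectionRule n} {s : ℕ}
    (hs : 1 ≤ s) {opt ε : ℝ} {y : E n} (hy : y ∈ (core f σ s opt ε).support) :
    (supp y).card ≤ s :=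
  card_supp_of_mem_support_coreLoop hs _ _ _ _ ((card_initial s).le.trans (min_le_right _ _))
    (supp_argminOn_subset _ _) hy

/-! ### Amplification by repetition -/

theorem card_supp_of_mem_support_robustLoop {f : E n → ℝ} {σ : SelectionRule n} {s : ℕ}
    (hs : 1 ≤ s) {opt ε : ℝ} (k : ℕ) (b : E n) (hb : (supp b).card ≤ s) {y : E n}
    (hy : y ∈ (robustLoop f σ s opt ε k b).support) : (supp y).card ≤ s := by
  induction k generalizing b with
  | zero =>
    rw [robustLoop, PMF.mem_support_pure_iff] at hy
    exact hy ▸ hb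
  | succ k ih =>
    rw [robustLoop] at hy
    obtain ⟨x, hx, hy⟩ := (PMF.mem_support_bind_iff _ _ _).1 hy
    refine ih _ ?_ hy
    split_ifs
    · exact card_supp_of_mem_support_core hs hx
    · exact hb

/-- Repetition amplifies the success probability. -/
theorem robustLoop_failure {f : E n → ℝ} {σ : SelectionRule n} {s : ℕ} {opt ε θ : ℝ} {q : ENNReal}
    (hq : (core f σ s opt ε).toOuterMeasure {y | θ < f y} ≤ q) (k : ℕ) (b : E n) :
    (robustLoop f σ s opt ε k b).toOuterMeasure {y | θ < f y} ≤ q ^ k ∧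
    (f b ≤ θ → (robustLoop f σ s opt ε k b).toOuterMeasure {y | θ < f y} ≤ 0) := by
  induction k generalizing b with
  | zero =>
    refine ⟨by simpa using toOuterMeasure_le_one _ _, fun hb => ?_⟩
    rw [robustLoop, toOuterMeasure_pure_of_notMem]
    simpa using hb
  | succ k ih =>
    rw [robustLoop]
    -- A best value at most θ is never lost, so failure requires every call to fail.
    constructor
    · have := toOuterMeasure_bind_le (core f σ s opt ε)
        (fun x => robustLoop f σ s opt ε k (if f x < f b then x else b)) {y | θ < f y}
        {y | θ < f y} (u := q ^ k) (v := 0) (fun x _ => (ih _).1) (fun x hx => (ih _).2 ?_)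
      · rw [add_zero] at this
        exact this.trans (by rw [pow_succ']; exact mul_le_mul_left hq _)
      · simp only [Set.mem_ofPred_eq, not_lt] at hx
        split_ifs with h
        · exact hx
        · exact (not_lt.1 h).trans hx
    · intro hb
      have := toOuterMeasure_bind_le (core f σ s opt ε)
        (fun x => robustLoop f σ s opt ε k (if f x < f b then x else b)) {y | θ < f y}
        ∅ (u := 0) (v := 0) (fun x hx => hx.elim) (fun x _ => (ih _).2 ?_)
      · simpa using this
      · split_ifs with h
        · exact h.le.trans hb
        · exact hb

theorem robust_failure {f : E n → ℝ} {σ : SelectionRule n} {s : ℕ} {opt ε B θ : ℝ} (hn : 0 < n)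
    (hq : (core f σ s opt ε).toOuterMeasure {y | θ < f y} ≤ ENNReal.ofReal (5 / 9))
    (hL : 1 ≤ Real.log ((f 0 - B) / ε)) :
    (robust f σ s opt ε B).toOuterMeasure {y | θ < f y} ≤
      ENNReal.ofReal (1 / (6 * n * Real.log ((f 0 - B) / ε))) := by
  refine (robustLoop_failure hq _ _).1.trans ?_
  set L := Real.log ((f 0 - B) / ε)
  have hn' : (0 : ℝ) < n := by exact_mod_cast hn
  have hX : 0 < 6 * (n : ℝ) * L := by positivity
  set k := ⌈5 * Real.log (6 * (n : ℝ) * L)⌉₊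
  rw [← ENNReal.ofReal_pow (by norm_num)]
  refine ENNReal.ofReal_le_ofReal ?_
  -- This makes 5·log X calls enough for failure probability 1/X.
  have h1 : (5 / 9 : ℝ) ≤ Real.exp (-(1 / 5)) := by
    have := Real.add_one_le_exp (-(1 / 5) : ℝ)
    linarith
  calc (5 / 9 : ℝ) ^ k ≤ Real.exp (-(1 / 5)) ^ k := by gcongr
    _ = Real.exp (-(k / 5)) := by
      rw [← Real.exp_nat_mul]; congr 1; ring
    _ ≤ Real.exp (-Real.log (6 * n * L)) := by
      rw [Real.exp_le_exp]
      have := Nat.le_ceil (5 * Real.log (6 * (n : ℝ) * L))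
      linarith
    _ = 1 / (6 * n * L) := by
      rw [Real.exp_neg, Real.exp_log hX, one_div]

/-! ### The bisection -/

theorem card_supp_of_mem_support_searchLoop {f : E n → ℝ} {σ : SelectionRule n} {s : ℕ}
    (hs : 1 ≤ s) {B ε : ℝ} (hε : 0 < ε) (l : ℝ) (b : E n) (r : ℝ) (hb : (supp b).card ≤ s)
    {y : E n} (hy : y ∈ (searchLoop f σ s B ε hε l b r).support) : (supp y).card ≤ s := by
  fun_induction searchLoop f σ s B ε hε l b r with
  | case1 l b r h ih1 ih2 =>
    obtain ⟨x, hx, hy⟩ := (PMF.mem_support_bind_iff _ _ _).1 hy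
    split_ifs at hy with h1
    · exact ih1 hb hy
    · exact ih2 x h1 (card_supp_of_mem_support_robustLoop hs _ _ (by simp [supp_zero]) hx) hy
  | case2 l b r h =>
    rw [PMF.mem_support_pure_iff] at hy
    exact hy ▸ hb

/-- Union bound over the passes of the search loop. -/
theorem searchLoop_failure {f : E n → ℝ} {σ : SelectionRule n} {s : ℕ} {B ε F : ℝ}
    (hε : 0 < ε) {δ : ENNReal} (hδ : ∀ m, F ≤ m →
      (robust f σ s m (ε / 3) B).toOuterMeasure {y | m + ε / 3 < f y} ≤ δ)
    (J : ℕ) (l : ℝ) (b : E n) (r : ℝ) (hl : l ≤ F) (hb : f b = r)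
    (hJ : r - l - 2 * ε / 3 ≤ ε / 3 * 2 ^ J) :
    (searchLoop f σ s B ε hε l b r).toOuterMeasure {y | F + ε < f y} ≤ J * δ := by
  induction J generalizing l b r with
  | zero =>
    rw [searchLoop, dif_neg (by linarith), toOuterMeasure_pure_of_notMem]
    · exact zero_le
    · simp only [Set.mem_ofPred_eq, not_lt]
      linarith
  | succ J ih =>
    -- The quantity r - l - 2ε/3 at least halves in the branches followed, while l ≤ F persists; at
    -- exit f b = r ≤ l + ε ≤ F + ε.
    rw [pow_succ] at hJ
    rw [searchLoop]
    split_ifs with h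
    · push_cast
      rw [add_mul, one_mul]
      set m := (l + r) / 2 with hm
      have hlow : ∀ x, f x ≤ m + ε / 3 →
          (searchLoop f σ s B ε hε l x (f x)).toOuterMeasure {y | F + ε < f y} ≤ J * δ :=
        fun x hx => ih l x (f x) hl rfl (by linarith)
      rcases le_or_gt F m with hF | hF
      · refine (toOuterMeasure_bind_le _ _ _ {y | m + ε / 3 < f y} (u := 1) (v := J * δ)
          (fun x _ => toOuterMeasure_le_one _ _) (fun x hx => ?_)).trans ?_
        · rw [Set.mem_ofPred_eq] at hx
          rw [dif_neg hx]
          exact hlow x (not_lt.1 hx)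
        · rw [mul_one, add_comm]
          exact add_le_add le_rfl (hδ m hF)
      -- For a guess below F either outcome preserves the invariant, so no failure probability is
      -- charged.
      · refine (toOuterMeasure_bind_le _ _ _ ∅ (u := 0) (v := J * δ)
          (fun x hx => hx.elim) (fun x _ => ?_)).trans ?_
        · split_ifs with hx
          · exact ih m b r hF.le hb (by linarith)
          · exact hlow x (not_lt.1 hx)
        · simp
    · rw [toOuterMeasure_pure_of_notMem]
      · exact zero_le
      · simp only [Set.mem_ofPred_eq, not_lt]
        linarith

/-! ### From near-optimal value to support recovery -/

theorem minAbs_nonneg (x : E n) : 0 ≤ minAbs x := Real.iInf_nonneg fun _ => abs_nonneg _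

theorem minAbs_le {x : E n} {i : Fin n} (hi : x i ≠ 0) : minAbs x ≤ |x i| :=
  ciInf_le (Set.finite_range fun i : {i : Fin n // x i ≠ 0} => |x i|).bddBelow ⟨i, hi⟩

theorem minAbs_zero : minAbs (0 : E n) = 0 := by
  have : IsEmpty {i : Fin n // (0 : E n) i ≠ 0} := ⟨fun i => i.2 rfl⟩
  exact Real.iInf_of_isEmpty _

/-- A sparse vector of almost optimal value contains the target support. -/
theorem supp_subset_of_le {f : E n → ℝ} {s t : ℕ} {m : ℝ} (hm : 0 < m) (hc : IsRSC f (s + t) m)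
    {xstar : E n} (hsparse : (supp xstar).card ≤ t)
    (hopt : ∀ i ∈ supp xstar, (∇ f xstar) i = 0) {ε : ℝ}
    (hε : ε < -(1 / (2 * m)) * rgoc f xstar s ^ 2 + m / 2 * minAbs xstar ^ 2)
    {x : E n} (hx : (supp x).card ≤ s) (hval : f x ≤ f xstar + ε) : supp xstar ⊆ supp x := by
  intro i hi
  by_contra hix
  have hxi : x i = 0 := by simpa [mem_supp] using hix
  -- Only the part of x off T pairs with the gradient at `xstar`, and it is s-sparse, so ζ applies
  -- to it.
  set u := restrict x (supp xstar)ᶜ with hu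
  have huk : ∀ k, u k = if k ∈ supp xstar then 0 else x k := fun k => by
    simp [hu, restrict]
  have h1 : (supp (x - xstar)).card ≤ s + t :=
    (Finset.card_le_card (supp_sub_subset (Finset.Subset.refl _) (Finset.Subset.refl _))).trans
      ((Finset.card_union_le _ _).trans (by omega))
  have h2 := hc xstar x h1
  have h3 : inner ℝ (∇ f xstar) (x - xstar) = inner ℝ (∇ f xstar) u := by
    rw [inner_eq_sum, inner_eq_sum]
    refine Finset.sum_congr rfl fun k _ => ?_
    by_cases hk : k ∈ supp xstar
    · simp [hopt k hk]
    · rw [huk, if_neg hk, PiLp.sub_apply,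
        apply_eq_zero_of_supp_subset (Finset.Subset.refl _) hk, sub_zero]
  have h4 : (supp u).card ≤ s := by
    refine (Finset.card_le_card ?_).trans hx
    rw [supp_subset_iff]
    intro k hk
    rw [huk, apply_eq_zero_of_supp_subset (Finset.Subset.refl _) hk, ite_self]
  have h5 := (abs_le.1 ((rgoc_spec f xstar s).2 u h4)).1
  have h6 : ‖u‖ ^ 2 + minAbs xstar ^ 2 ≤ ‖x - xstar‖ ^ 2 := by
    have h7 : minAbs xstar ^ 2 ≤ ∑ k ∈ supp xstar, (x - xstar) k ^ 2 := by
      calc minAbs xstar ^ 2 ≤ |xstar i| ^ 2 :=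
            pow_le_pow_left₀ (minAbs_nonneg _) (minAbs_le (mem_supp.1 hi)) 2
        _ = (x - xstar) i ^ 2 := by simp [hxi]
        _ ≤ _ := Finset.single_le_sum (f := fun k => (x - xstar) k ^ 2)
            (fun k _ => sq_nonneg _) hi
    rw [hu, norm_restrict_sq, norm_sq_eq_sum, ← Finset.sum_add_sum_compl (supp xstar), add_comm]
    refine add_le_add h7 (Finset.sum_le_sum fun k hk => le_of_eq ?_)
    rw [PiLp.sub_apply, apply_eq_zero_of_supp_subset (Finset.Subset.refl _)
      (Finset.mem_compl.1 hk), sub_zero]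
  set ζ := rgoc f xstar s
  -- Worst case over ‖u‖ of (m/2)‖u‖² - ζ‖u‖, namely -ζ²/(2m).
  have h7 : 0 ≤ (m * ‖u‖ - ζ) ^ 2 / (2 * m) := by positivity
  have h8 : (m * ‖u‖ - ζ) ^ 2 / (2 * m) =
      m / 2 * ‖u‖ ^ 2 - ζ * ‖u‖ + 1 / (2 * m) * ζ ^ 2 := by
    field_simp; ring
  have h9 := mul_le_mul_of_nonneg_left h6 (by positivity : 0 ≤ m / 2)
  linarith

/-- The output of the algorithm has nearly optimal value with high probability. -/
theorem arht_failure {f : E n → ℝ} (hf : Differentiable ℝ f) (hbdd : BddBelow (Set.range f))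
    (hsm : IsRSS f 2 (rss f 2)) (hp : 0 < rss f 2) {s t : ℕ} {m κ : ℝ} (hm : 0 < m)
    (hc : IsRSC f (s + t) m) (hκ : rss f 2 = κ * m) (hκ1 : 1 ≤ κ) (σ : SelectionRule n)
    {xstar : E n} (hsparse : (supp xstar).card ≤ t) (ht : 0 < t) (hn : 0 < n)
    (hst : (t : ℝ) * (12 * κ + 6) ≤ s) {ε : ℝ} (hε : 0 < ε) :
    (arht f σ s ε hε).toOuterMeasure {y | f xstar + ε < f y} ≤ ENNReal.ofReal (1 / n) := by
  set B := ⨅ x, f x with hB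
  have hBle : ∀ x, B ≤ f x := fun x => ciInf_le hbdd x
  rw [arht, ← hB]
  rcases le_or_gt (f 0 - B) ε with hD | hD
  -- The search loop makes no pass, so zero passes are charged, even at cost ⊤.
  · have h := searchLoop_failure (σ := σ) (s := s) (B := B) (F := f xstar) hε (δ := ⊤)
      (fun _ _ => le_top) 0 B 0 (f 0) (hBle _) rfl (by linarith)
    refine h.trans ?_
    simp
  have hn' : (0 : ℝ) < n := by exact_mod_cast hn
  have hε3 : 0 < ε / 3 := by positivity
  have hD0 : 0 < f 0 - B := hε.trans hD
  set L := Real.log ((f 0 - B) / (ε / 3)) with hL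
  have hq : 3 ≤ (f 0 - B) / (ε / 3) := by
    rw [le_div_iff₀ hε3]; linarith
  have hL1 : 1 ≤ L := by
    rw [hL, Real.le_log_iff_exp_le (by linarith)]
    exact (Real.exp_one_lt_d9.le.trans (by norm_num)).trans hq
  have hDL : f 0 - B = ε / 3 * Real.exp L := by
    rw [hL, Real.exp_log (by positivity)]
    field_simp
  -- As 2·log 2 ≥ 1, 2^J ≥ exp L; and J ≤ 2L + 1 ≤ 6L because L ≥ 1.
  set J := ⌈2 * L⌉₊ with hJ
  have hJle : (J : ℝ) ≤ 2 * L + 1 := (Nat.ceil_lt_add_one (by positivity)).le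
  have h2J : Real.exp L ≤ 2 ^ J := by
    have h1 : (2 : ℝ) ^ J = Real.exp (J * Real.log 2) := by
      rw [Real.exp_nat_mul, Real.exp_log (by norm_num)]
    rw [h1, Real.exp_le_exp]
    have h2 := Nat.le_ceil (2 * L)
    have h3 := Real.log_two_gt_d9
    have h4 : (2 * L) * (1 / 2) ≤ (J : ℝ) * Real.log 2 :=
      mul_le_mul h2 (by linarith) (by norm_num) (by positivity)
    linarith
  have h := searchLoop_failure (σ := σ) (s := s) (B := B) (F := f xstar) hε
    (δ := ENNReal.ofReal (1 / (6 * n * L)))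
    (fun m' hm' => robust_failure hn (core_failure hf hsm hp hm hc hκ hκ1 σ hsparse ht hst hε3 hm'
      ((hBle xstar).trans hm') hD0 hL1) hL1) J B 0 (f 0) (hBle _) rfl (by
        have := mul_le_mul_of_nonneg_left h2J hε3.le
        linarith)
  refine h.trans ?_
  rw [← ENNReal.ofReal_natCast, ← ENNReal.ofReal_mul (Nat.cast_nonneg _)]
  refine ENNReal.ofReal_le_ofReal ?_
  have hL0 : 0 < L := by linarith
  calc (J : ℝ) * (1 / (6 * n * L)) ≤ (6 * L) * (1 / (6 * n * L)) := by
        gcongr; linarith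
    _ = 1 / n := by field_simp

/-- The implication is needed only on the support of the law, since sparsity of the output is known
only there. -/
theorem le_toOuterMeasure_of_compl {α : Type*} (p : PMF α) {A C : Set α} {q : ℝ}
    (h : ∀ a ∈ p.support, a ∉ C → a ∈ A) (hq0 : 0 ≤ q)
    (hq : p.toOuterMeasure C ≤ ENNReal.ofReal q) :
    ENNReal.ofReal (1 - q) ≤ p.toOuterMeasure A := by
  rw [ENNReal.ofReal_sub _ hq0, ENNReal.ofReal_one, tsub_le_iff_right]
  have h1 : p.toOuterMeasure Set.univ ≤ p.toOuterMeasure (A ∪ C) := by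
    refine p.toOuterMeasure_mono fun a ha => ?_
    by_cases hC : a ∈ C
    · exact Or.inr hC
    · exact Or.inl (h a ha.2 hC)
  rw [toOuterMeasure_univ] at h1
  exact h1.trans ((MeasureTheory.measure_union_le _ _).trans (add_le_add le_rfl hq))

end ARHT

theorem mainTheorem4 {n : ℕ} (f : ARHT.E n → ℝ) (hf : Differentiable ℝ f)
    (hbdd : BddBelow (Set.range f))
    (s sstar : ℕ) (xstar : ARHT.E n)
    (hsparse : (ARHT.supp xstar).card ≤ sstar)
    (hopt : ∀ i ∈ ARHT.supp xstar, (gradient f xstar) i = 0)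
    (hrss : ∃ ρ : ℝ, ARHT.IsRSS f 2 ρ)
    (hrsc : 0 < ARHT.rsc f (s + sstar))
    (hs : (sstar : ℝ) * max (4 * (ARHT.rss f 2 / ARHT.rsc f (s + sstar)) + 7)
      (12 * (ARHT.rss f 2 / ARHT.rsc f (s + sstar)) + 6) ≤ (s : ℝ))
    (hmin : ARHT.rgoc f xstar s / ARHT.rsc f (s + sstar) < ARHT.minAbs xstar)
    (ε : ℝ) (hε : 0 < ε)
    (hε' : ε < -(1 / (2 * ARHT.rsc f (s + sstar))) * ARHT.rgoc f xstar s ^ 2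
      + ARHT.rsc f (s + sstar) / 2 * ARHT.minAbs xstar ^ 2)
    (σ : ARHT.SelectionRule n) :
    ENNReal.ofReal (1 - 1 / (n : ℝ)) ≤
      (ARHT.arht f σ s ε hε).toOuterMeasure
        {x | ARHT.supp xstar ⊆ ARHT.supp x ∧ (ARHT.supp x).card ≤ s} := by
  -- For the zero vector `minAbs` takes its default value 0, which cannot exceed ζ/m ≥ 0.
  have hx0 : xstar ≠ 0 := by
    rintro rfl
    rw [ARHT.minAbs_zero] at hmin
    exact absurd hmin (not_lt.2 (div_nonneg (ARHT.rgoc_spec f 0 s).1 hrsc.le))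
  obtain ⟨i, hi⟩ : ∃ i, xstar i ≠ 0 := by
    by_contra! h
    exact hx0 (by ext i; simpa using h i)
  have hn : 0 < n := i.pos
  have : NeZero n := ⟨hn.ne'⟩
  have ht : 0 < sstar := (Finset.card_pos.2 ⟨i, ARHT.mem_supp.2 hi⟩).trans_le hsparse
  set m := ARHT.rsc f (s + sstar) with hm
  have hc : ARHT.IsRSC f (s + sstar) m := ARHT.isRSC_rsc hrsc
  have hsm : ARHT.IsRSS f 2 (ARHT.rss f 2) := ARHT.isRSS_rss hrss
    ⟨m, fun ρ hρ => ARHT.le_of_isRSC_of_isRSS (by omega) (by omega) hc hρ⟩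
  have hmp : m ≤ ARHT.rss f 2 := ARHT.le_of_isRSC_of_isRSS (by omega) (by omega) hc hsm
  set κ := ARHT.rss f 2 / m with hκ
  have hκ1 : 1 ≤ κ := (one_le_div hrsc).2 hmp
  have hst : (sstar : ℝ) * (12 * κ + 6) ≤ s :=
    (mul_le_mul_of_nonneg_left (le_max_right _ _) (Nat.cast_nonneg _)).trans hs
  have hs1 : 1 ≤ s := by
    have : (0 : ℝ) < s := lt_of_lt_of_le
      (mul_pos (by exact_mod_cast ht) (by linarith)) hst
    exact_mod_cast this
  refine ARHT.le_toOuterMeasure_of_compl _ (fun x hx hxC => ?_) (by positivity)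
    (ARHT.arht_failure hf hbdd hsm (hrsc.trans_le hmp) hrsc hc (div_mul_cancel₀ _ hrsc.ne').symm
      hκ1 σ hsparse ht hn hst hε)
  have hcard : (ARHT.supp x).card ≤ s :=
    ARHT.card_supp_of_mem_support_searchLoop hs1 hε _ _ _ (by simp [ARHT.supp_zero]) hx
  exact ⟨ARHT.supp_subset_of_le hrsc hc hsparse hopt hε' hcard (not_lt.1 hxC), hcard⟩
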